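/- Let $N\ge 1$. Write $\mathcal{CN}(\mathbf 0,\boldsymbol\Gamma)$ for the circularly symmetric complex Gaussian law on $\mathbb C^N$ with covariance $\boldsymbol\Gamma$, i.e. the law of $\mathbf g$ with $(\Re\mathbf g,\Im\mathbf g)\sim\mathcal N\!\left(\mathbf 0,\tfrac12\begin{bmatrix}\Re\boldsymbol\Gamma&-\Im\boldsymbol\Gamma\\ \Im\boldsymbol\Gamma&\Re\boldsymbol\Gamma\end{bmatrix}\right)$. Let $\mathbf R\in\mathbb C^{N\times N}$ be Hermitian positive semidefinite (such as the spatial correlation matrix of the $N$ ports of a fluid antenna), and let $\mathbf R=\mathbf U\,\mathrm{diag}(\lambda_1,\dots,\lambda_N)\,\mathbf U^H$ be any eigendecomposition with $\mathbf U=(u_{n,k})$ unitary and $\lambda_1\ge\dots\ge\lambda_N$ (so $\lambda_N\ge 0$). Let $\eta>0$ be the mean channel power, $\bar\gamma>0$ the average SNR and $\gamma_{\mathrm{th}}>0$ the outage threshold. The true outage probability is $$P_{\mathrm{out}}=\mathbb P\Big(\bar\gamma\,\max_{1\le n\le N}\frac{|g_n|^2}{\eta}\le\gamma_{\mathrm{th}}\Big),\qquad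 \mathbf g\sim\mathcal{CN}(\mathbf 0,\eta\mathbf R),$$ and, for $1\le K\le N$, the outage probability of the $K$-truncated Karhunen–Loève channel is $$\tilde P_{\mathrm{out}}^{(K)}=\mathbb P\Big(\Big|\sum_{k=1}^{K}\sqrt{\lambda_k}\,u_{n,k}\,z_k\Big|^2\le\frac{\gamma_{\mathrm{th}}}{\bar\gamma}\ \text{ for all } n=1,\dots,N\Big),\qquad z_1,\dots,z_K\ \text{i.i.d. } \mathcal{CN}(0,1).$$ Then $$\tilde P_{\mathrm{out}}^{(1)}\ \ge\ \tilde P_{\mathrm{out}}^{(2)}\ \ge\ \cdots\ \ge\ \tilde P_{\mathrm{out}}^{(N)}=P_{\mathrm{out}}.$$ Moreover, this applies to the Jakes model: for every normalized aperture $W>0$ the Jakes matrix with entries $[\mathbf R]_{k,l}=J_0\!\left(2\pi|k-l|W/(N-1)\right)$, $1\le k,l\le N$ (and $\mathbf R=(1)$ if $N=1$), where $J_0(x)=\frac1\pi\int_0^\pi\cos(x\sin\theta)\,d\theta$ is the zeroth-order Bessel function of the first kind, is Hermitian positive semidefinite. -/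

import Mathlib

open MeasureTheory ProbabilityTheory
open scoped ComplexOrder Matrix

noncomputable section

/-- The Bessel function of the first kind of order zero, as the Bessel integral
`J₀(x) = (1/π) ∫₀^π cos (x sin θ) dθ`. -/
def besselJ0 (x : ℝ) : ℝ :=
  (1 / Real.pi) * ∫ θ in (0 : ℝ)..Real.pi, Real.cos (x * Real.sin θ)

/-- The Jakes correlation matrix of `N` equally spaced ports on an aperture of `W` wavelengths,
`R k l = J₀ (2π |k - l| W / (N - 1))`. For `N = 1` its only entry is `J₀ 0 = 1`. -/
def jakesMatrix (N : ℕ) (W : ℝ) : Matrix (Fin N) (Fin N) ℂ :=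
  Matrix.of fun k l =>
    ((besselJ0 (2 * Real.pi * |(k : ℝ) - (l : ℝ)| * W / ((N : ℝ) - 1)) : ℝ) : ℂ)

/-- `CN(0, 1)` on `ℂ`: independent real and imaginary parts, each `N(0, 1/2)`. -/
def stdComplexGaussian : Measure ℂ :=
  ((gaussianReal 0 (1 / 2)).prod (gaussianReal 0 (1 / 2))).map fun p => ⟨p.1, p.2⟩

/-- Covariance matrix of `(Re g, Im g)` for a circularly symmetric `g ∼ CN(0, Γ)`. -/
def realCompositeCov {N : ℕ} (Γ : Matrix (Fin N) (Fin N) ℂ) :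
    Matrix (Fin N ⊕ Fin N) (Fin N ⊕ Fin N) ℝ :=
  (1 / 2 : ℝ) • Matrix.fromBlocks (Γ.map Complex.re) (-(Γ.map Complex.im))
    (Γ.map Complex.im) (Γ.map Complex.re)

/-- The circularly symmetric complex Gaussian law `CN(0, Γ)` on `ℂ^N`
(for a Hermitian positive semidefinite `Γ`, possibly singular). -/
def complexGaussian {N : ℕ} (Γ : Matrix (Fin N) (Fin N) ℂ) : Measure (Fin N → ℂ) :=
  (multivariateGaussian 0 (realCompositeCov Γ)).map
    fun v n => ⟨v (Sum.inl n), v (Sum.inr n)⟩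

/-- Instantaneous SNR after port selection, `γ = γ̄ · max_n |g_n|² / η`. -/
def selectedSNR {N : ℕ} (γbar η : ℝ) (g : Fin N → ℂ) : ℝ :=
  γbar * ⨆ n, ‖g n‖ ^ 2 / η

/-- True outage probability `P_out = ℙ(γ ≤ γ_th)` for the channel `g ∼ CN(0, η R)`. -/
def outageProb {N : ℕ} (R : Matrix (Fin N) (Fin N) ℂ) (η γbar γth : ℝ) : ℝ :=
  (complexGaussian ((η : ℂ) • R)).real {g | selectedSNR γbar η g ≤ γth}

/-- CDF at `x` of the normalized maximum gain of the `K`-truncated Karhunen–Loève channel: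
the probability, for i.i.d. `z_1, …, z_K ∼ CN(0, 1)`, that
`|∑_{k ≤ K} √λ_k u_{n,k} z_k|² ≤ x` at every port `n`. -/
def klCDF {N : ℕ} (U : Matrix (Fin N) (Fin N) ℂ) (lam : Fin N → ℝ) (K : ℕ) (hK : K ≤ N)
    (x : ℝ) : ℝ :=
  (Measure.pi fun _ : Fin K => stdComplexGaussian).real
    {z | ∀ n, ‖∑ k : Fin K, ((√(lam (Fin.castLE hK k)) : ℝ) : ℂ) * U n (Fin.castLE hK k) * z k‖ ^ 2
      ≤ x}

/-- Outage probability of the `K`-truncated Karhunen–Loève channel. -/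
def klOutageProb {N : ℕ} (U : Matrix (Fin N) (Fin N) ℂ) (lam : Fin N → ℝ) (K : ℕ) (hK : K ≤ N)
    (γbar γth : ℝ) : ℝ :=
  klCDF U lam K hK (γth / γbar)

end

/-! Freeze the last mode at `w`. The outage event for `K + 1` modes becomes a section `S` of a
symmetric convex set, and at `w = 0` this section is the `K`-mode event `T`. Midpoints of `S` and
`-S` lie in `T`, so for a symmetric log-concave law `μ S ^ 2 = μ S * μ (-S) ≤ μ T ^ 2` (Anderson,
`measure_section_le`). Averaging over `w` gives monotonicity in `K`. The log-concavity used is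
Prékopa–Leindler at the midpoint: it is proved on `ℝ` by applying Brunn–Minkowski to superlevel
sets, then passes to densities, products and linear images, hence to i.i.d. `CN(0, 1)` vectors. For
`K = N`, `A = √η U diag(√λ)` satisfies `A * Aᴴ = η R`, and characteristic functions identify the law
of `A z` with `CN(0, η R)`. The Jakes matrix is positive because `J₀` is an average of cosines. -/

/-! ### Brunn–Minkowski and Prékopa–Leindler on the line. -/

/-- Midpoint version of the one-dimensional Brunn–Minkowski inequality. -/
theorem Real.volume_add_volume_le_two_mul_of_midpoint {s t u : Set ℝ} (hs : MeasurableSet s)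
    (ht : MeasurableSet t) (hs₀ : s.Nonempty) (ht₀ : t.Nonempty)
    (hu : ∀ x ∈ s, ∀ y ∈ t, (x + y) / 2 ∈ u) : volume s + volume t ≤ 2 * volume u := by
  have key : ∀ K ⊆ s, ∀ L ⊆ t, IsCompact K → IsCompact L → K.Nonempty → L.Nonempty →
      volume K + volume L ≤ 2 * volume u := by
    intro K hK L hL hKc hLc hK₀ hL₀
    obtain ⟨a, haK, ha⟩ := hKc.exists_isGreatest hK₀
    obtain ⟨b, hbL, hb⟩ := hLc.exists_isLeast hL₀
    -- With `a = max K` and `b = min L`, the translates `K + b` and `L + a` lie in `2u` and meet at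
    -- most at `a + b`.
    have h1 : volume ((fun x => x - b) ⁻¹' K) = volume K := by
      simp [sub_eq_add_neg, measure_preimage_add_right]
    have h2 : volume ((fun x => x - a) ⁻¹' L) = volume L := by
      simp [sub_eq_add_neg, measure_preimage_add_right]
    have h3 : volume ((fun x => x * (2⁻¹ : ℝ)) ⁻¹' u) = 2 * volume u := by
      rw [Real.volume_preimage_mul_right (by norm_num)]
      norm_num
    have hd : AEDisjoint volume ((fun x => x - b) ⁻¹' K) ((fun x => x - a) ⁻¹' L) := by
      refine measure_mono_null (t := {a + b}) ?_ (by simp)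
      rintro x ⟨hx1, hx2⟩
      have := ha hx1
      have := hb hx2
      simp only [Set.mem_singleton_iff]
      linarith
    rw [← h1, ← h2, ← h3, ← measure_union₀ _ hd]
    · refine measure_mono ?_
      rintro x (hx | hx)
      · have := hu _ (hK hx) _ (hL hbL)
        simpa [div_eq_mul_inv] using this
      · have := hu _ (hK haK) _ (hL hx)
        simpa [div_eq_mul_inv] using this
    · exact (hLc.measurableSet.preimage (by fun_prop)).nullMeasurableSet
  obtain ⟨x₀, hx₀⟩ := hs₀
  obtain ⟨y₀, hy₀⟩ := ht₀
  rw [hs.measure_eq_iSup_isCompact, ht.measure_eq_iSup_isCompact]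
  simp only [iSup_and']
  refine ENNReal.biSup_add_biSup_le' ⟨∅, by simp⟩ ⟨∅, by simp⟩ fun K hK L hL => ?_
  -- The approximating compacts may be empty; adding a point makes `key` applicable.
  refine le_trans ?_ (key (insert x₀ K) (Set.insert_subset hx₀ hK.1) (insert y₀ L)
    (Set.insert_subset hy₀ hL.1) (hK.2.insert _) (hL.2.insert _) (Set.insert_nonempty _ _)
    (Set.insert_nonempty _ _))
  gcongr <;> exact Set.subset_insert _ _

theorem ENNReal.mul_le_sq_of_add_le {a b c : ENNReal} (h : a + b ≤ 2 * c) : a * b ≤ c ^ 2 := by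
  rcases eq_or_ne c ⊤ with rfl | hc
  · simp
  have hab : a + b ≠ ⊤ := ne_top_of_le_ne_top (ENNReal.mul_ne_top (by simp) hc) h
  obtain ⟨ha, hb⟩ := ENNReal.add_ne_top.1 hab
  lift a to NNReal using ha
  lift b to NNReal using hb
  lift c to NNReal using hc
  norm_cast at h ⊢
  have h' : (a : ℝ) + b ≤ 2 * c := by exact_mod_cast h
  have : (a : ℝ) * b ≤ c ^ 2 := by nlinarith [sq_nonneg ((a : ℝ) - b), a.2, b.2, c.2]
  exact_mod_cast this

open Set in
/-- Arithmetic form of the Prékopa–Leindler inequality for functions with supremum one. -/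
theorem Real.lintegral_add_lintegral_le_of_midpoint {f g h : ℝ → ℝ} (hf : Measurable f)
    (hg : Measurable g) (hh : Measurable h) (hf₀ : 0 ≤ f) (hg₀ : 0 ≤ g) (hh₀ : 0 ≤ h)
    (hf₁ : IsLUB (range f) 1) (hg₁ : IsLUB (range g) 1)
    (H : ∀ x y, f x * g y ≤ h ((x + y) / 2) ^ 2) :
    (∫⁻ x, ENNReal.ofReal (f x)) + ∫⁻ x, ENNReal.ofReal (g x)
      ≤ 2 * ∫⁻ x, ENNReal.ofReal (h x) := by
  have hm : ∀ k : ℝ → ℝ, Measurable fun t : ℝ => volume {a | t < k a} := fun k =>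
    Antitone.measurable fun s t hst => measure_mono fun a ha => lt_of_le_of_lt hst ha
  rw [lintegral_eq_lintegral_meas_lt _ (.of_forall hf₀) hf.aemeasurable,
    lintegral_eq_lintegral_meas_lt _ (.of_forall hg₀) hg.aemeasurable,
    lintegral_eq_lintegral_meas_lt _ (.of_forall hh₀) hh.aemeasurable,
    ← lintegral_add_left (hm f), ← lintegral_const_mul _ (hm h)]
  refine setLIntegral_mono' measurableSet_Ioi fun t (ht : 0 < t) => ?_
  -- Brunn–Minkowski needs nonempty sets: the common supremum 1 makes both superlevel sets nonempty
  -- for `t < 1` and empty beyond.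
  rcases lt_or_ge t 1 with h1 | h1
  · refine Real.volume_add_volume_le_two_mul_of_midpoint (measurableSet_lt (by fun_prop) hf)
      (measurableSet_lt (by fun_prop) hg) ?_ ?_ fun x hx y hy => ?_
    · obtain ⟨_, ⟨x, rfl⟩, hx, _⟩ := hf₁.exists_between h1
      exact ⟨x, hx⟩
    · obtain ⟨_, ⟨x, rfl⟩, hx, _⟩ := hg₁.exists_between h1
      exact ⟨x, hx⟩
    · have hx : t < f x := hx
      have hy : t < g y := hy
      refine lt_of_pow_lt_pow_left₀ 2 (hh₀ _) (lt_of_lt_of_le ?_ (H x y))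
      nlinarith
  · have e : ∀ k : ℝ → ℝ, IsLUB (range k) 1 → volume {a | t < k a} = 0 := fun k hk => by
      rw [show {a | t < k a} = ∅ from ?_, measure_empty]
      ext a
      simpa using (hk.1 ⟨a, rfl⟩).trans h1
    rw [e f hf₁, e g hg₁]
    simp

open Set in
/-- The Prékopa–Leindler inequality for bounded functions on the line. -/
theorem Real.lintegral_mul_lintegral_le_of_bddAbove {f g h : ℝ → ℝ} (hf : Measurable f)
    (hg : Measurable g) (hh : Measurable h) (hf₀ : 0 ≤ f) (hg₀ : 0 ≤ g) (hh₀ : 0 ≤ h)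
    (hf₁ : BddAbove (range f)) (hg₁ : BddAbove (range g))
    (H : ∀ x y, f x * g y ≤ h ((x + y) / 2) ^ 2) :
    (∫⁻ x, ENNReal.ofReal (f x)) * ∫⁻ x, ENNReal.ofReal (g x)
      ≤ (∫⁻ x, ENNReal.ofReal (h x)) ^ 2 := by
  by_cases hfz : ∀ x, f x = 0
  · simp [hfz]
  by_cases hgz : ∀ x, g x = 0
  · simp [hgz]
  push Not at hfz hgz
  have pos : ∀ k : ℝ → ℝ, 0 ≤ k → BddAbove (range k) → (∃ x, k x ≠ 0) → 0 < ⨆ x, k x := by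
    rintro k hk hb ⟨x, hx⟩
    exact lt_of_lt_of_le (lt_of_le_of_ne (hk x) hx.symm) (le_ciSup hb x)
  have lub : ∀ k : ℝ → ℝ, BddAbove (range k) → 0 < ⨆ x, k x →
      IsLUB (range fun x => k x / ⨆ x, k x) 1 := by
    intro k hb hp
    constructor
    · rintro _ ⟨x, rfl⟩
      exact (div_le_one hp).2 (le_ciSup hb x)
    · intro c hc
      have : (⨆ x, k x) ≤ c * ⨆ x, k x :=
        ciSup_le fun x => (div_le_iff₀ hp).1 (hc ⟨x, rfl⟩)
      exact le_of_mul_le_mul_right (by simpa using this) hp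
  have hM := pos f hf₀ hf₁ hfz
  have hN := pos g hg₀ hg₁ hgz
  have lf := lub f hf₁ hM
  have lg := lub g hg₁ hN
  set M := ⨆ x, f x
  set N := ⨆ x, g x
  -- Dividing `h` by the geometric mean of the two suprema preserves the hypothesis.
  have hMN : 0 < √(M * N) := Real.sqrt_pos.2 (mul_pos hM hN)
  have key := ENNReal.mul_le_sq_of_add_le <|
    Real.lintegral_add_lintegral_le_of_midpoint (hf.div_const M) (hg.div_const N)
      (hh.div_const √(M * N)) (fun x => div_nonneg (hf₀ x) hM.le)
      (fun x => div_nonneg (hg₀ x) hN.le) (fun x => div_nonneg (hh₀ x) hMN.le) lf lg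
      (fun x y => by
        rw [div_mul_div_comm, div_pow, Real.sq_sqrt (mul_pos hM hN).le]
        gcongr
        exact H x y)
  have scale : ∀ (k : ℝ → ℝ) (c : ℝ), Measurable k → 0 < c →
      ∫⁻ x, ENNReal.ofReal (k x) = ENNReal.ofReal c * ∫⁻ x, ENNReal.ofReal (k x / c) := by
    intro k c hk hc
    rw [← lintegral_const_mul _ (by fun_prop)]
    refine lintegral_congr fun x => ?_
    rw [← ENNReal.ofReal_mul hc.le, mul_div_cancel₀ _ hc.ne']
  rw [scale f M hf hM, scale g N hg hN, scale h _ hh hMN, mul_mul_mul_comm,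
    ← ENNReal.ofReal_mul hM.le, mul_pow, ← ENNReal.ofReal_pow hMN.le,
    Real.sq_sqrt (mul_pos hM hN).le]
  gcongr

/-- The **Prékopa–Leindler inequality** on the line, at the midpoint. -/
theorem Real.lintegral_mul_lintegral_le_sq {f g h : ℝ → ENNReal} (hf : Measurable f)
    (hg : Measurable g) (hh : Measurable h) (H : ∀ x y, f x * g y ≤ h ((x + y) / 2) ^ 2) :
    (∫⁻ x, f x) * ∫⁻ x, g x ≤ (∫⁻ x, h x) ^ 2 := by
  -- Capping all three functions at the same level preserves the hypothesis; monotone convergence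
  -- then removes the cap.
  have trunc : ∀ k : ℕ, (∫⁻ x, min (f x) k) * ∫⁻ x, min (g x) k ≤ (∫⁻ x, h x) ^ 2 := by
    intro k
    have hk : ∀ a : ENNReal, min a k ≠ ⊤ := fun a =>
      ne_top_of_le_ne_top (ENNReal.natCast_ne_top k) (min_le_right _ _)
    have hb : ∀ q : ℝ → ENNReal, BddAbove (Set.range fun x => (min (q x) k).toReal) := by
      rintro q
      refine ⟨k, ?_⟩
      rintro _ ⟨x, rfl⟩
      exact ENNReal.toReal_le_of_le_ofReal (by positivity) (by simp)
    have := Real.lintegral_mul_lintegral_le_of_bddAbove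
      (f := fun x => (min (f x) k).toReal) (g := fun x => (min (g x) k).toReal)
      (h := fun x => (min (h x) k).toReal)
      (by fun_prop) (by fun_prop) (by fun_prop)
      (fun _ => ENNReal.toReal_nonneg) (fun _ => ENNReal.toReal_nonneg)
      (fun _ => ENNReal.toReal_nonneg) (hb f) (hb g) (fun x y => by
        rw [← ENNReal.toReal_mul, ← ENNReal.toReal_pow]
        refine ENNReal.toReal_mono (ENNReal.pow_ne_top (hk _)) ?_
        rcases le_total (h ((x + y) / 2)) k with hle | hle
        · rw [min_eq_left hle]
          exact (mul_le_mul' (min_le_left _ _) (min_le_left _ _)).trans (H x y)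
        · rw [min_eq_right hle, sq]
          exact mul_le_mul' (min_le_right _ _) (min_le_right _ _))
    simp only [ENNReal.ofReal_toReal (hk _)] at this
    refine this.trans ?_
    gcongr
    exact min_le_left _ _
  have mono : ∀ q : ℝ → ENNReal, Monotone fun (k : ℕ) x => min (q x) k := by
    intro q i j hij x
    exact min_le_min le_rfl (by exact_mod_cast hij)
  have lim : ∀ q : ℝ → ENNReal, Measurable q →
      ∫⁻ x, q x = ⨆ k : ℕ, ∫⁻ x, min (q x) k := by
    intro q hq
    rw [← lintegral_iSup (fun k => by fun_prop) (mono q)]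
    refine lintegral_congr fun x => ?_
    rw [← inf_iSup_eq, ENNReal.iSup_natCast, inf_top_eq]
  rw [lim f hf, lim g hg]
  simp only [ENNReal.iSup_mul, ENNReal.mul_iSup, iSup_le_iff]
  intro i j
  refine le_trans ?_ (trunc (max i j))
  exact mul_le_mul' (lintegral_mono (mono f (le_max_right i j)))
    (lintegral_mono (mono g (le_max_left i j)))

/-! ### Midpoint log-concave measures and Anderson's inequality. -/

/-- A measure satisfies the midpoint Prékopa–Leindler inequality. -/
def MeasureTheory.Measure.IsMidpointLogConcave {E : Type*} [AddCommGroup E] [Module ℝ E]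
    [MeasurableSpace E] (μ : Measure E) : Prop :=
  ∀ f g h : E → ENNReal, Measurable f → Measurable g → Measurable h →
    (∀ x y, f x * g y ≤ h (midpoint ℝ x y) ^ 2) →
    (∫⁻ x, f x ∂μ) * ∫⁻ x, g x ∂μ ≤ (∫⁻ x, h x ∂μ) ^ 2

namespace MeasureTheory.Measure.IsMidpointLogConcave

variable {E F : Type*} [AddCommGroup E] [Module ℝ E] [MeasurableSpace E]
  [AddCommGroup F] [Module ℝ F] [MeasurableSpace F]

theorem volume_real : (volume : Measure ℝ).IsMidpointLogConcave := by
  intro f g h hf hg hh H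
  refine Real.lintegral_mul_lintegral_le_sq hf hg hh fun x y => ?_
  have := H x y
  rwa [midpoint_eq_smul_add, smul_eq_mul, invOf_eq_inv, mul_comm (2⁻¹ : ℝ), ← div_eq_mul_inv]
    at this

theorem withDensity {μ : Measure E} (hμ : μ.IsMidpointLogConcave) {φ : E → ENNReal}
    (hφ : Measurable φ) (H : ∀ x y, φ x * φ y ≤ φ (midpoint ℝ x y) ^ 2) :
    (μ.withDensity φ).IsMidpointLogConcave := by
  intro f g h hf hg hh hfgh
  rw [lintegral_withDensity_eq_lintegral_mul _ hφ hf,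
    lintegral_withDensity_eq_lintegral_mul _ hφ hg, lintegral_withDensity_eq_lintegral_mul _ hφ hh]
  refine hμ _ _ _ (hφ.mul hf) (hφ.mul hg) (hφ.mul hh) fun x y => ?_
  simp only [Pi.mul_apply]
  rw [mul_mul_mul_comm, mul_pow]
  exact mul_le_mul' (H x y) (hfgh x y)

theorem map {μ : Measure E} (hμ : μ.IsMidpointLogConcave) (L : E →ₗ[ℝ] F) (hL : Measurable L) :
    (μ.map L).IsMidpointLogConcave := by
  intro f g h hf hg hh hfgh
  rw [lintegral_map hf hL, lintegral_map hg hL, lintegral_map hh hL]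
  refine hμ _ _ _ (hf.comp hL) (hg.comp hL) (hh.comp hL) fun x y => ?_
  have := hfgh (L x) (L y)
  simpa [midpoint_eq_smul_add] using this

/-- The inequality for `ν` on fibres is exactly the hypothesis for `μ` on the inner integrals. -/
theorem prod {μ : Measure E} {ν : Measure F} [SFinite μ] [SFinite ν]
    (hμ : μ.IsMidpointLogConcave) (hν : ν.IsMidpointLogConcave) :
    (μ.prod ν).IsMidpointLogConcave := by
  intro f g h hf hg hh hfgh
  rw [lintegral_prod _ hf.aemeasurable, lintegral_prod _ hg.aemeasurable,
    lintegral_prod _ hh.aemeasurable]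
  refine hμ _ _ _ hf.lintegral_prod_right' hg.lintegral_prod_right' hh.lintegral_prod_right'
    fun x x' => hν _ _ _ (by fun_prop) (by fun_prop) (by fun_prop) fun y y' => ?_
  simpa [midpoint_eq_smul_add] using hfgh (x, y) (x', y')

theorem gaussianReal (m : ℝ) {v : NNReal} (hv : v ≠ 0) :
    (gaussianReal m v).IsMidpointLogConcave := by
  rw [gaussianReal_of_var_ne_zero m hv]
  refine volume_real.withDensity (measurable_gaussianPDF m v) fun x y => ?_
  simp only [gaussianPDF]
  rw [← ENNReal.ofReal_mul (gaussianPDFReal_nonneg _ _ _),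
    ← ENNReal.ofReal_pow (gaussianPDFReal_nonneg _ _ _)]
  refine ENNReal.ofReal_le_ofReal ?_
  have hv' : (0 : ℝ) < v := lt_of_le_of_ne v.2 (by exact_mod_cast hv.symm)
  simp only [gaussianPDFReal]
  rw [mul_mul_mul_comm, ← Real.exp_add, mul_pow, ← sq, ← Real.exp_nat_mul, midpoint_eq_smul_add,
    invOf_eq_inv, smul_eq_mul]
  gcongr
  rw [← add_div, mul_div_assoc', div_le_div_iff_of_pos_right (by positivity)]
  push_cast
  nlinarith [sq_nonneg (x - y)]

theorem dirac_of_subsingleton [Subsingleton E] (x : E) : (dirac x).IsMidpointLogConcave := by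
  intro f g h hf hg hh hfgh
  rw [lintegral_dirac' _ hf, lintegral_dirac' _ hg, lintegral_dirac' _ hh]
  simpa using hfgh x x

theorem pi_const {μ : Measure E} [SigmaFinite μ] (hμ : μ.IsMidpointLogConcave) (n : ℕ) :
    (Measure.pi fun _ : Fin n => μ).IsMidpointLogConcave := by
  induction n with
  | zero =>
    rw [Measure.pi_of_empty _ 0]
    exact dirac_of_subsingleton _
  | succ n ih =>
    have e := (measurePreserving_piFinSuccAbove (fun _ : Fin (n + 1) => μ) 0).symm
    rw [← e.map_eq]
    let L : E × (Fin n → E) →ₗ[ℝ] (Fin (n + 1) → E) :=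
      { toFun := fun p => Fin.insertNth (α := fun _ => E) 0 p.1 p.2
        map_add' := fun p q => by
          ext i
          refine Fin.cases ?_ (fun j => ?_) i <;> simp
        map_smul' := fun c p => by
          ext i
          refine Fin.cases ?_ (fun j => ?_) i <;> simp }
    exact (hμ.prod ih).map L e.measurable

/-- A form of **Anderson's inequality**: among all translates of the section of a symmetric
convex set, the central one has the largest measure. -/
theorem measure_section_le {μ : Measure E} [IsFiniteMeasure μ] [MeasurableNeg E] [μ.IsNegInvariant]
    (hμ : μ.IsMidpointLogConcave) {s t : Set E} (hs : MeasurableSet s) (ht : MeasurableSet t)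
    (hst : ∀ x ∈ s, ∀ y ∈ s, midpoint ℝ x (-y) ∈ t) : μ s ≤ μ t := by
  have h := hμ (s.indicator 1) ((-s).indicator 1) (t.indicator 1) (measurable_one.indicator hs)
    (measurable_one.indicator hs.neg) (measurable_one.indicator ht) fun x y => by
      by_cases hx : x ∈ s
      · by_cases hy : y ∈ -s
        · have := hst x hx (-y) hy
          rw [neg_neg] at this
          simp [hx, hy, this, Set.indicator_of_mem]
        · simp [Set.indicator_of_notMem hy]
      · simp [hx]
  rw [lintegral_indicator_one hs, lintegral_indicator_one hs.neg, lintegral_indicator_one ht,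
    measure_neg, ← sq] at h
  exact (ENNReal.pow_le_pow_left_iff two_ne_zero).1 h

end MeasureTheory.Measure.IsMidpointLogConcave

/-! ### Positivity of the Jakes matrix. -/

theorem besselJ0_abs (x : ℝ) : besselJ0 |x| = besselJ0 x := by
  simp only [besselJ0]
  rcases abs_choice x with h | h <;> simp [h]

theorem besselJ0_sub (x y : ℝ) : besselJ0 (x - y) = (1 / Real.pi) * ∫ θ in (0 : ℝ)..Real.pi,
    (Real.cos (x * Real.sin θ) * Real.cos (y * Real.sin θ)
      + Real.sin (x * Real.sin θ) * Real.sin (y * Real.sin θ)) := by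
  simp only [besselJ0, sub_mul, Real.cos_sub]

open scoped MatrixOrder in
/-- `J₀` is a positive definite function. -/
theorem posSemidef_besselJ0_sub {ι : Type*} [Fintype ι] (x : ι → ℝ) :
    (Matrix.of fun k l => ((besselJ0 (x k - x l) : ℝ) : ℂ)).PosSemidef := by
  have hreal : (Matrix.of fun k l => besselJ0 (x k - x l)).PosSemidef := by
    refine .of_dotProduct_mulVec_nonneg ?_ fun v => ?_
    · ext k l
      simp only [Matrix.conjTranspose_apply, Matrix.of_apply, star_trivial]
      rw [← besselJ0_abs, abs_sub_comm, besselJ0_abs]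
    -- The integrand is `|∑ v_k exp(i x_k sin θ)|²`.
    · have : star v ⬝ᵥ (Matrix.of fun k l => besselJ0 (x k - x l)) *ᵥ v = (1 / Real.pi) *
          ∫ θ in (0 : ℝ)..Real.pi, ((∑ k, v k * Real.cos (x k * Real.sin θ)) ^ 2
            + (∑ k, v k * Real.sin (x k * Real.sin θ)) ^ 2) := by
        simp only [dotProduct, Matrix.mulVec, Matrix.of_apply, star_trivial, Pi.star_apply,
          besselJ0_sub, Finset.mul_sum]
        have e : ∀ θ : ℝ, (∑ k, v k * Real.cos (x k * Real.sin θ)) ^ 2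
            + (∑ k, v k * Real.sin (x k * Real.sin θ)) ^ 2 = ∑ k, ∑ l, v k * v l *
            (Real.cos (x k * Real.sin θ) * Real.cos (x l * Real.sin θ)
              + Real.sin (x k * Real.sin θ) * Real.sin (x l * Real.sin θ)) := by
          intro θ
          simp only [sq, Finset.sum_mul_sum, ← Finset.sum_add_distrib]
          refine Finset.sum_congr rfl fun k _ => Finset.sum_congr rfl fun l _ => ?_
          ring
        simp only [e]
        rw [intervalIntegral.integral_finsetSum
          fun k _ => Continuous.intervalIntegrable (by fun_prop) _ _, Finset.mul_sum]
        refine Finset.sum_congr rfl fun k _ => ?_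
        rw [intervalIntegral.integral_finsetSum
          fun k _ => Continuous.intervalIntegrable (by fun_prop) _ _, Finset.mul_sum]
        refine Finset.sum_congr rfl fun l _ => ?_
        rw [intervalIntegral.integral_const_mul]
        ring
      rw [this]
      exact mul_nonneg (by positivity)
        (intervalIntegral.integral_nonneg Real.pi_pos.le fun θ _ => by positivity)
  classical
  -- A real Gram factorization stays one over `ℂ`, which transfers positivity to complex vectors.
  obtain ⟨B, hB⟩ := CStarAlgebra.nonneg_iff_eq_star_mul_self.1 hreal.nonneg
  rw [Matrix.star_eq_conjTranspose] at hB
  have : (Matrix.of fun k l => ((besselJ0 (x k - x l) : ℝ) : ℂ))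
      = (B.map Complex.ofReal)ᴴ * B.map Complex.ofReal := by
    ext k l
    have := congrFun (congrFun hB k) l
    simp only [Matrix.of_apply, Matrix.mul_apply, Matrix.conjTranspose_apply] at this ⊢
    simp [this]
  rw [this]
  exact Matrix.posSemidef_conjTranspose_mul_self _

theorem posSemidef_jakesMatrix (N : ℕ) (W : ℝ) : (jakesMatrix N W).PosSemidef := by
  convert posSemidef_besselJ0_sub fun k : Fin N => 2 * Real.pi * (k : ℝ) * W / ((N : ℝ) - 1)
    using 1
  ext k l
  simp only [jakesMatrix, Matrix.of_apply]
  congr 1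
  rw [← besselJ0_abs (2 * Real.pi * |(k : ℝ) - (l : ℝ)| * W / ((N : ℝ) - 1)),
    ← besselJ0_abs (2 * Real.pi * (k : ℝ) * W / ((N : ℝ) - 1) - _)]
  congr 1
  rw [← sub_div, ← sub_mul, ← mul_sub]
  simp only [abs_mul, abs_div, abs_abs]

/-! ### Monotonicity in the number of modes. -/

instance isProbabilityMeasure_stdComplexGaussian : IsProbabilityMeasure stdComplexGaussian :=
  Measure.isProbabilityMeasure_map Complex.measurableEquivRealProd.symm.measurable.aemeasurable

theorem isMidpointLogConcave_stdComplexGaussian : stdComplexGaussian.IsMidpointLogConcave :=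
  ((Measure.IsMidpointLogConcave.gaussianReal 0 (by norm_num)).prod
    (Measure.IsMidpointLogConcave.gaussianReal 0 (by norm_num))).map
    Complex.equivRealProdLm.symm.toLinearMap Complex.measurableEquivRealProd.symm.measurable

instance isNegInvariant_gaussianReal_zero (v : NNReal) : (gaussianReal 0 v).IsNegInvariant :=
  ⟨gaussianReal_map_neg.trans (by rw [neg_zero])⟩

instance isNegInvariant_stdComplexGaussian : stdComplexGaussian.IsNegInvariant := by
  have hm : Measurable fun p : ℝ × ℝ => (⟨p.1, p.2⟩ : ℂ) :=
    Complex.measurableEquivRealProd.symm.measurable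
  constructor
  have h : ((gaussianReal 0 (1 / 2)).prod (gaussianReal 0 (1 / 2))).map Neg.neg
      = (gaussianReal 0 (1 / 2)).prod (gaussianReal 0 (1 / 2)) := by
    conv_rhs => rw [← Measure.neg_eq_self (gaussianReal 0 (1 / 2))]
    exact (Measure.map_prod_map _ _ measurable_neg measurable_neg).symm
  rw [Measure.neg, stdComplexGaussian, Measure.map_map measurable_neg hm]
  conv_rhs => rw [← h, Measure.map_map hm measurable_neg]
  congr 1

/-- Adding an independent Gaussian mode can only decrease the probability that all the linear
forms stay in a disc. -/
theorem pi_stdComplexGaussian_succ_le {ι : Type*} [Countable ι] {K : ℕ}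
    (a : ι → Fin (K + 1) → ℂ) (x : ℝ) :
    (Measure.pi fun _ : Fin (K + 1) => stdComplexGaussian)
        {z | ∀ n, ‖∑ k, a n k * z k‖ ^ 2 ≤ x}
      ≤ (Measure.pi fun _ : Fin K => stdComplexGaussian)
        {z | ∀ n, ‖∑ k, a n k.castSucc * z k‖ ^ 2 ≤ x} := by
  have hmeas : ∀ {m : ℕ} (b : ι → Fin m → ℂ) (c : ι → ℂ),
      MeasurableSet {z : Fin m → ℂ | ∀ n, ‖∑ k, b n k * z k + c n‖ ^ 2 ≤ x} := by
    intro m b c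
    simp only [Set.ofPred_forall]
    exact MeasurableSet.iInter fun n => measurableSet_le (by fun_prop) (by fun_prop)
  have hS : MeasurableSet {z : Fin (K + 1) → ℂ | ∀ n, ‖∑ k, a n k * z k‖ ^ 2 ≤ x} := by
    simpa using hmeas a 0
  have e := (measurePreserving_piFinSuccAbove (fun _ : Fin (K + 1) => stdComplexGaussian)
    (Fin.last K)).symm
  rw [← e.measure_preimage hS.nullMeasurableSet, Measure.prod_apply (e.measurable hS)]
  refine (lintegral_mono (g := fun _ => (Measure.pi fun _ : Fin K => stdComplexGaussian)
    {z | ∀ n, ‖∑ k, a n k.castSucc * z k‖ ^ 2 ≤ x}) fun w => ?_).trans_eq (by simp)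
  refine (isMidpointLogConcave_stdComplexGaussian.pi_const K).measure_section_le
    (measurable_prodMk_left (e.measurable hS)) (by simpa using hmeas (fun n k => a n k.castSucc) 0)
    fun z hz z' hz' n => ?_
  have h1 := hz n
  have h2 := hz' n
  simp only [MeasurableEquiv.piFinSuccAbove_symm_apply, Fin.insertNthEquiv_last,
    Fin.sum_univ_castSucc, Fin.snocEquiv_apply, Fin.snoc_castSucc, Fin.snoc_last] at h1 h2
  -- Both points share the same `w`, so its contribution cancels in the half-difference.
  have : ∑ k, a n k.castSucc * midpoint ℝ z (-z') k
      = (1 / 2 : ℂ) * ((∑ k, a n k.castSucc * z k + a n (Fin.last K) * w)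
        - (∑ k, a n k.castSucc * z' k + a n (Fin.last K) * w)) := by
    rw [add_sub_add_right_eq_sub, ← Finset.sum_sub_distrib, Finset.mul_sum]
    refine Finset.sum_congr rfl fun k _ => ?_
    simp [midpoint_eq_smul_add]
    ring
  rw [this]
  set p := ∑ k, a n k.castSucc * z k + a n (Fin.last K) * w
  set q := ∑ k, a n k.castSucc * z' k + a n (Fin.last K) * w
  have hpq : ‖(1 / 2 : ℂ) * (p - q)‖ ≤ (‖p‖ + ‖q‖) / 2 := by
    rw [norm_mul]
    have := norm_sub_le p q
    norm_num
    linarith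
  nlinarith [norm_nonneg ((1 / 2 : ℂ) * (p - q)), sq_nonneg (‖p‖ - ‖q‖)]

theorem klCDF_antitone {N : ℕ} (U : Matrix (Fin N) (Fin N) ℂ) (lam : Fin N → ℝ) (x : ℝ)
    {K₁ K₂ : ℕ} (h₁₂ : K₁ ≤ K₂) (h₂ : K₂ ≤ N) :
    klCDF U lam K₂ h₂ x ≤ klCDF U lam K₁ (h₁₂.trans h₂) x := by
  induction K₂, h₁₂ using Nat.le_induction with
  | base => rfl
  | succ K hK ih =>
    refine le_trans ?_ (ih (by omega))
    exact ENNReal.toReal_mono (measure_ne_top _ _) (pi_stdComplexGaussian_succ_le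
      (fun n k => ((√(lam (Fin.castLE h₂ k)) : ℝ) : ℂ) * U n (Fin.castLE h₂ k)) x)

/-! ### Linear images of i.i.d. complex Gaussians. -/

theorem integral_exp_re_mul_stdComplexGaussian (w : ℂ) :
    ∫ z, Complex.exp (((star w * z).re : ℝ) * Complex.I) ∂stdComplexGaussian
      = Complex.exp (-(((w.re ^ 2 + w.im ^ 2 : ℝ) : ℂ) / 4)) := by
  have hm : Measurable fun p : ℝ × ℝ => (⟨p.1, p.2⟩ : ℂ) :=
    Complex.measurableEquivRealProd.symm.measurable
  rw [stdComplexGaussian, integral_map hm.aemeasurable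
    (Measurable.aestronglyMeasurable (by fun_prop))]
  have e : ∀ p : ℝ × ℝ, Complex.exp (((star w * (⟨p.1, p.2⟩ : ℂ)).re : ℝ) * Complex.I)
      = Complex.exp (w.re * p.1 * Complex.I) * Complex.exp (w.im * p.2 * Complex.I) := by
    intro p
    rw [← Complex.exp_add]
    congr 1
    simp [Complex.mul_re]
    ring
  simp_rw [e]
  rw [integral_prod_mul (fun a : ℝ => Complex.exp (w.re * a * Complex.I))
      (fun a : ℝ => Complex.exp (w.im * a * Complex.I)), ← charFun_apply_real,
    ← charFun_apply_real, charFun_gaussianReal, charFun_gaussianReal, ← Complex.exp_add]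
  congr 1
  push_cast
  ring

/-- The real matrix of the real linear map underlying a complex matrix. -/
def Matrix.realify {m n : Type*} (A : Matrix m n ℂ) : Matrix (m ⊕ m) (n ⊕ n) ℝ :=
  Matrix.fromBlocks (A.map Complex.re) (-(A.map Complex.im)) (A.map Complex.im) (A.map Complex.re)

theorem realCompositeCov_mul_conjTranspose {N : ℕ} {n : Type*} [Fintype n]
    (A : Matrix (Fin N) n ℂ) :
    realCompositeCov (A * Aᴴ) = (1 / 2 : ℝ) • (A.realify * A.realifyᵀ) := by
  rw [realCompositeCov, Matrix.realify, Matrix.fromBlocks_transpose, Matrix.fromBlocks_multiply]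
  congr 2 <;> ext i j <;>
    simp [Matrix.mul_apply, Complex.re_sum, Complex.im_sum, Finset.sum_add_distrib] <;>
    ring

theorem posSemidef_realCompositeCov_mul_conjTranspose {N : ℕ} {n : Type*} [Fintype n]
    (A : Matrix (Fin N) n ℂ) : (realCompositeCov (A * Aᴴ)).PosSemidef := by
  rw [realCompositeCov_mul_conjTranspose, ← Matrix.conjTranspose_eq_transpose_of_trivial]
  exact (Matrix.posSemidef_self_mul_conjTranspose _).smul (by norm_num)

/-- Real and imaginary parts of a complex vector, as one real vector. -/
def realParts {N : ℕ} (g : Fin N → ℂ) : EuclideanSpace ℝ (Fin N ⊕ Fin N) :=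
  WithLp.toLp 2 (Sum.elim (fun n => (g n).re) (fun n => (g n).im))

theorem measurable_realParts {N : ℕ} : Measurable (realParts (N := N)) := by
  refine (WithLp.measurable_toLp 2 _).comp (measurable_pi_iff.2 ?_)
  rintro (n | n) <;> simp <;> fun_prop

/-- Moving `A` onto `c` as its adjoint leaves a sum over the independent `z k`, so the
characteristic function factors. -/
theorem inner_realParts_mulVec {N : ℕ} {n : Type*} [Fintype n] (A : Matrix (Fin N) n ℂ)
    (z : n → ℂ) (c : Fin N → ℂ) :
    inner ℝ (realParts (A *ᵥ z)) (realParts c) = ∑ k, (star ((Aᴴ *ᵥ c) k) * z k).re := by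
  have h1 : inner ℝ (realParts (A *ᵥ z)) (realParts c) = (star c ⬝ᵥ A *ᵥ z).re := by
    simp [PiLp.inner_apply, realParts, dotProduct, Finset.sum_add_distrib, Complex.re_sum]
  rw [h1, Matrix.dotProduct_mulVec, dotProduct, Complex.re_sum]
  refine Finset.sum_congr rfl fun k _ => ?_
  rw [← Pi.star_apply, Matrix.star_mulVec, Matrix.conjTranspose_conjTranspose]

theorem realify_transpose_mulVec_realParts {N : ℕ} {n : Type*} [Fintype n]
    (A : Matrix (Fin N) n ℂ) (c : Fin N → ℂ) :
    A.realifyᵀ *ᵥ (realParts c).ofLp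
      = Sum.elim (fun k => ((Aᴴ *ᵥ c) k).re) (fun k => ((Aᴴ *ᵥ c) k).im) := by
  rw [Matrix.realify, realParts, Matrix.fromBlocks_transpose, Matrix.fromBlocks_mulVec]
  congr 1 <;> ext k <;>
    simp [Matrix.mulVec, dotProduct, Complex.re_sum, Complex.im_sum, Finset.sum_add_distrib, add_comm]

/-- A linear image of i.i.d. `CN(0, 1)` variables is circularly symmetric Gaussian. -/
theorem map_mulVec_pi_stdComplexGaussian {N : ℕ} {n : Type*} [Fintype n]
    (A : Matrix (Fin N) n ℂ) :
    (Measure.pi fun _ : n => stdComplexGaussian).map (fun z => A *ᵥ z)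
      = complexGaussian (A * Aᴴ) := by
  have hA : Measurable fun z : n → ℂ => A *ᵥ z := by
    refine measurable_pi_iff.2 fun i => ?_
    simp only [Matrix.mulVec, dotProduct]
    fun_prop
  have hV : Measurable fun (v : EuclideanSpace ℝ (Fin N ⊕ Fin N)) (n : Fin N) =>
      (⟨v (Sum.inl n), v (Sum.inr n)⟩ : ℂ) := by
    refine measurable_pi_iff.2 fun i => ?_
    exact Complex.measurableEquivRealProd.symm.measurable.comp (by fun_prop :
      Measurable fun v : EuclideanSpace ℝ (Fin N ⊕ Fin N) => (v (Sum.inl i), v (Sum.inr i)))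
  have key : ((Measure.pi fun _ : n => stdComplexGaussian).map (fun z => A *ᵥ z)).map realParts
      = multivariateGaussian 0 (realCompositeCov (A * Aᴴ)) := by
    have : IsProbabilityMeasure (((Measure.pi fun _ : n => stdComplexGaussian).map
        (fun z => A *ᵥ z)).map realParts) := by
      rw [Measure.map_map measurable_realParts hA]
      exact Measure.isProbabilityMeasure_map (measurable_realParts.comp hA).aemeasurable
    refine Measure.ext_of_charFun (funext fun t => ?_)
    obtain ⟨c, rfl⟩ : ∃ c : Fin N → ℂ, t = realParts c :=
      ⟨fun n => ⟨t (Sum.inl n), t (Sum.inr n)⟩, by ext (i | i) <;> rfl⟩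
    rw [charFun_multivariateGaussian (posSemidef_realCompositeCov_mul_conjTranspose A),
      charFun_apply, Measure.map_map measurable_realParts hA,
      integral_map (measurable_realParts.comp hA).aemeasurable
        (Measurable.aestronglyMeasurable (by fun_prop))]
    simp only [Function.comp_apply, inner_realParts_mulVec, Complex.ofReal_sum, Finset.sum_mul,
      Complex.exp_sum]
    rw [integral_fintype_prod_eq_prod
      (f := fun k z => Complex.exp (((star ((Aᴴ *ᵥ c) k) * z).re : ℝ) * Complex.I))]
    simp only [integral_exp_re_mul_stdComplexGaussian, ← Complex.exp_sum]
    congr 1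
    have h2 : (realParts c).ofLp ⬝ᵥ realCompositeCov (A * Aᴴ) *ᵥ (realParts c).ofLp
        = (∑ k, (((Aᴴ *ᵥ c) k).re ^ 2 + ((Aᴴ *ᵥ c) k).im ^ 2)) / 2 := by
      rw [realCompositeCov_mul_conjTranspose, Matrix.smul_mulVec, dotProduct_smul,
        ← Matrix.mulVec_mulVec, Matrix.dotProduct_mulVec, ← Matrix.mulVec_transpose,
        realify_transpose_mulVec_realParts]
      simp [dotProduct, Finset.sum_add_distrib, sq]
      ring
    rw [h2]
    simp [Finset.sum_div]
    refine Finset.sum_congr rfl fun k _ => ?_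
    ring
  rw [complexGaussian, ← key, Measure.map_map hV measurable_realParts]
  -- Splitting into real parts and reassembling is definitionally the identity.
  conv_lhs => rw [← Measure.map_id (μ := Measure.map _ _)]
  rfl

/-! ### The full expansion and the main theorem. -/

theorem klOutageProb_eq_outageProb {N : ℕ} (hN : 1 ≤ N) (U : Matrix (Fin N) (Fin N) ℂ)
    {lam : Fin N → ℝ} (hlam : ∀ k, 0 ≤ lam k) {η γbar γth : ℝ} (hη : 0 < η) (hγ : 0 < γbar) :
    klOutageProb U lam N le_rfl γbar γth
      = outageProb (U * Matrix.diagonal (fun k => ((lam k : ℝ) : ℂ)) * Uᴴ) η γbar γth := by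
  have : Nonempty (Fin N) := ⟨⟨0, hN⟩⟩
  set A : Matrix (Fin N) (Fin N) ℂ :=
    (√η : ℂ) • (U * Matrix.diagonal fun k => ((√(lam k) : ℝ) : ℂ)) with hAdef
  have hA : (η : ℂ) • (U * Matrix.diagonal (fun k => ((lam k : ℝ) : ℂ)) * Uᴴ) = A * Aᴴ := by
    have h1 : (Matrix.diagonal fun k => ((√(lam k) : ℝ) : ℂ))
        * (Matrix.diagonal fun k => ((√(lam k) : ℝ) : ℂ))
        = Matrix.diagonal fun k => ((lam k : ℝ) : ℂ) := by
      rw [Matrix.diagonal_mul_diagonal]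
      congr 1
      ext k
      rw [← Complex.ofReal_mul, Real.mul_self_sqrt (hlam k)]
    have h2 : (Matrix.diagonal fun k => ((√(lam k) : ℝ) : ℂ))ᴴ
        = Matrix.diagonal fun k => ((√(lam k) : ℝ) : ℂ) := by
      rw [Matrix.diagonal_conjTranspose]
      congr 1
      ext k
      simp
    rw [hAdef, Matrix.conjTranspose_smul, Matrix.conjTranspose_mul, h2, Matrix.smul_mul,
      Matrix.mul_smul, smul_smul, ← h1]
    congr 1
    · simp [← Complex.ofReal_mul, Real.mul_self_sqrt hη.le]
    · simp only [Matrix.mul_assoc]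
  have hAm : Measurable fun z : Fin N → ℂ => A *ᵥ z := by
    refine measurable_pi_iff.2 fun i => ?_
    simp only [Matrix.mulVec, dotProduct]
    fun_prop
  rw [outageProb, hA, ← map_mulVec_pi_stdComplexGaussian, klOutageProb, klCDF,
    map_measureReal_apply hAm]
  · congr 1
    ext z
    simp only [Set.mem_ofPred_eq, Set.mem_preimage, selectedSNR]
    rw [mul_comm, ← le_div_iff₀ hγ, ciSup_le_iff (Set.finite_range _).bddAbove]
    refine forall_congr' fun n => ?_
    have : (A *ᵥ z) n
        = (√η : ℂ) * ∑ k, ((√(lam k) : ℝ) : ℂ) * U n k * z k := by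
      rw [hAdef, Matrix.smul_mulVec, Pi.smul_apply, smul_eq_mul, Matrix.mulVec, dotProduct]
      congr 1
      refine Finset.sum_congr rfl fun k _ => ?_
      rw [Matrix.mul_diagonal]
      ring
    rw [this, norm_mul, mul_pow, Complex.norm_real, Real.norm_eq_abs, sq_abs, Real.sq_sqrt hη.le,
      mul_div_cancel_left₀ _ hη.ne']
    rfl
  · simp only [selectedSNR]
    exact measurableSet_le ((Measurable.iSup fun n => by fun_prop).const_mul γbar) (by fun_prop)

/-- Conjugating back by `U` preserves positivity. The sign is needed for `√λ * √λ = λ`, as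
`Real.sqrt` vanishes on negatives. -/
theorem nonneg_of_posSemidef_unitary_conj {n : Type*} [Fintype n] [DecidableEq n]
    {U : Matrix n n ℂ} (hU : U ∈ Matrix.unitaryGroup n ℂ) {lam : n → ℝ}
    (h : (U * Matrix.diagonal (fun k => ((lam k : ℝ) : ℂ)) * Uᴴ).PosSemidef) (k : n) :
    0 ≤ lam k := by
  have h1 : Uᴴ * U = 1 := Matrix.mem_unitaryGroup_iff'.1 hU
  have h2 := h.conjTranspose_mul_mul_same U
  have h3 : Uᴴ * (U * Matrix.diagonal (fun k => ((lam k : ℝ) : ℂ)) * Uᴴ) * U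
      = Matrix.diagonal fun k => ((lam k : ℝ) : ℂ) := by
    rw [← Matrix.mul_assoc, ← Matrix.mul_assoc, h1, Matrix.one_mul, Matrix.mul_assoc, h1,
      Matrix.mul_one]
  rw [h3, Matrix.posSemidef_diagonal_iff] at h2
  exact_mod_cast h2 k

theorem mainTheorem4 (N : ℕ) (hN : 1 ≤ N) :
    (∀ W : ℝ, 0 < W → (jakesMatrix N W).PosSemidef) ∧
    ∀ (R : Matrix (Fin N) (Fin N) ℂ), R.PosSemidef →
      ∀ (U : Matrix (Fin N) (Fin N) ℂ) (lam : Fin N → ℝ),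
        U ∈ Matrix.unitaryGroup (Fin N) ℂ → Antitone lam →
        R = U * Matrix.diagonal (fun k => ((lam k : ℝ) : ℂ)) * Uᴴ →
      ∀ (η γbar γth : ℝ), 0 < η → 0 < γbar → 0 < γth →
        (∀ (K₁ K₂ : ℕ) (h₁₂ : K₁ ≤ K₂) (h₂ : K₂ ≤ N), 1 ≤ K₁ →
          klOutageProb U lam K₂ h₂ γbar γth ≤ klOutageProb U lam K₁ (h₁₂.trans h₂) γbar γth) ∧
        klOutageProb U lam N le_rfl γbar γth = outageProb R η γbar γth := by
  refine ⟨fun W _ => posSemidef_jakesMatrix N W, ?_⟩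
  rintro R hR U lam hU - rfl η γbar γth hη hγ -
  exact ⟨fun K₁ K₂ h₁₂ h₂ _ => klCDF_antitone U lam (γth / γbar) h₁₂ h₂,
    klOutageProb_eq_outageProb hN U (nonneg_of_posSemidef_unitary_conj hU hR) hη hγ⟩
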